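/- For $\theta>0$ let $C_m(x;\theta)={}_2F_0(-m,-x;-;-1/\theta)=\sum_{k=0}^m\binom mk\left(-\frac1\theta\right)^k x(x-1)\cdots(x-k+1)$, $m=0,1,2,\dots$, be the Charlier polynomials, which are orthogonal on $\mathbb Z_+=\{0,1,2,\dots\}$ with respect to the weight $W_\theta(x)=\theta^x/x!$. Put $$\|C_m(\cdot;\theta)\|^2=\sum_{x=0}^\infty C_m(x;\theta)^2W_\theta(x),\qquad \widetilde C_m(x;\theta)=W_\theta(x)^{1/2}\,\|C_m(\cdot;\theta)\|^{-1}\,C_m(x;\theta),$$ and let $$K^{\mathrm{Charlier}}_{N,\theta}(x,y)=\sum_{m=0}^{N-1}\widetilde C_m(x;\theta)\,\widetilde C_m(y;\theta),\qquad x,y\in\mathbb Z_+,$$ be the $N$-th Charlier Christoffel–Darboux kernel. For $s\in\mathbb R$ let $$K_s(x,y)=(2\pi\,x!\,y!\,2^{x+y})^{-1/2}\int_s^{+\infty}e^{-t^2/2}\,H_x(t/\sqrt2)\,H_y(t/\sqrt2)\,dt,\qquad x,y\in\mathbb Z_+,$$ be the discrete Hermite kernel, where $H_n$ are the classical Hermite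 polynomials ($H_0=1$, $H_{n+1}(t)=2tH_n(t)-H_n'(t)$). Lemma 4.4. Let $s\in\mathbb R$ be fixed and let $\theta(N)$, $N=1,2,\dots$, be real numbers with $\theta(N)=N+(s+o(1))N^{1/2}$ as $N\to\infty$ (so that $\theta(N)>0$ for all large $N$). Then $$\lim_{N\to\infty}K^{\mathrm{Charlier}}_{N,\theta(N)}(x,y)=K_s(x,y)\qquad\text{for all }x,y\in\mathbb Z_+ .$$ -/

import Mathlib

open Filter Topology Asymptotics

noncomputable section

namespace DiscreteHermite

/-- The Charlier weight `W_θ(x) = θ^x / x!` on the nonnegative integers. -/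
def charlierWeight (θ : ℝ) (x : ℕ) : ℝ := θ ^ x / (x.factorial : ℝ)

/-- The Charlier polynomial of degree `m` with parameter `θ`, in the standard normalization
`C_m(x; θ) = ₂F₀(-m, -x; -; -1/θ) = ∑_{k ≤ m} (m choose k) (-1/θ)^k x (x - 1) ⋯ (x - k + 1)`. -/
def charlierPoly (m : ℕ) (θ : ℝ) : Polynomial ℝ :=
  ∑ k ∈ Finset.range (m + 1),
    Polynomial.C ((m.choose k : ℝ) * (-1 / θ) ^ k) * descPochhammer ℝ k

/-- The norm of `C_m(·; θ)` in the weighted `ℓ²` space on `ℕ` with weight `W_θ`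
(for `θ > 0` the series converges, the weight decaying faster than any power). -/
def charlierNorm (m : ℕ) (θ : ℝ) : ℝ :=
  √(∑' x : ℕ, ((charlierPoly m θ).eval (x : ℝ)) ^ 2 * charlierWeight θ x)

/-- The normalized Charlier functions
`C̃_m(x; θ) = W_θ(x)^{1/2} ‖C_m(·; θ)‖⁻¹ C_m(x; θ)`. -/
def charlierFun (m : ℕ) (θ : ℝ) (x : ℕ) : ℝ :=
  √(charlierWeight θ x) * (charlierNorm m θ)⁻¹ * (charlierPoly m θ).eval (x : ℝ)

/-- The `N`-th Charlier Christoffel–Darboux kernel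
`K_{N,θ}(x, y) = ∑_{m=0}^{N-1} C̃_m(x; θ) C̃_m(y; θ)`. -/
def charlierKernel (N : ℕ) (θ : ℝ) (x y : ℕ) : ℝ :=
  ∑ m ∈ Finset.range N, charlierFun m θ x * charlierFun m θ y

/-- The classical (physicists') Hermite polynomials `H_n`, with leading coefficient `2^n`:
`H_0 = 1`, `H_{n+1}(t) = 2 t H_n(t) - H_n'(t)`. -/
def hermiteH : ℕ → Polynomial ℝ
  | 0 => 1
  | n + 1 => 2 * Polynomial.X * hermiteH n - Polynomial.derivative (hermiteH n)

/-- The discrete Hermite kernel with parameter `s`: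
`K_s(x, y) = (2π x! y! 2^{x+y})^{-1/2} ∫_s^∞ e^{-t²/2} H_x(t/√2) H_y(t/√2) dt`. -/
def hermiteKernel (s : ℝ) (x y : ℕ) : ℝ :=
  (2 * Real.pi * (x.factorial : ℝ) * (y.factorial : ℝ) * 2 ^ (x + y)) ^ (-(1 / 2) : ℝ) *
    ∫ t in Set.Ioi s,
      Real.exp (-t ^ 2 / 2) * (hermiteH x).eval (t / √2) * (hermiteH y).eval (t / √2)

end DiscreteHermite

end

/-!
The argument rests on the self-duality `C_m(x) = C_x(m)` of the Charlier polynomials on the lattice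
and on the norm formula `‖C_m‖² = e^θ m! / θ^m`. Together they turn the Christoffel-Darboux kernel
into a truncated Poisson expectation
`K_{N,θ}(x, y) = (x! y!)^{-1/2} E[θ^{x/2} C_x(ξ) · θ^{y/2} C_y(ξ); ξ < N]`, `ξ ∼ Poisson(θ)`,
with fixed degrees `x` and `y` (`charlierKernel_eq_sum`). Heuristically `(θ - ξ)/√θ` becomes a
standard Gaussian `t`, `θ^{x/2} C_x(ξ)` becomes the Hermite polynomial `He_x(t)`, and `ξ < N`
becomes `t > s`.

Convergence of moments is avoided by an exact recursion. Summation by parts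
(`sum_charlierWeight_mul_succ_succ`) expresses the expectation at `(x+1, y+1)` through the one at
`(x, y)` and a boundary term at the truncation point; integration by parts
(`hermiteTail_succ_succ`) gives the same recursion for `∫_s^∞ e^{-t²/2} He_x He_y`. The boundary
terms converge by the three-term recurrence (`tendsto_sqrt_pow_mul_charlierValue`) and Stirling's
formula. There remains `x = y = 0`, the central limit theorem for the Poisson law: its
distribution function is a Gamma tail (`integral_Ioi_gammaRatio`), to which dominated convergence
applies (`tendsto_integral_Ioi_gammaRatio`).
-/

open MeasureTheory

noncomputable section

namespace DiscreteHermite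

/-! ### Charlier polynomials on the lattice -/

/-- The value of the Charlier polynomial `C_m(·; θ)` at a lattice point `x : ℕ`. -/
def charlierValue (θ : ℝ) (m x : ℕ) : ℝ :=
  ∑ k ∈ Finset.range (m + 1), (m.choose k : ℝ) * (-1 / θ) ^ k * (x.descFactorial k : ℝ)

theorem charlierPoly_eval_natCast (m : ℕ) (θ : ℝ) (x : ℕ) :
    (charlierPoly m θ).eval (x : ℝ) = charlierValue θ m x := by
  simp [charlierPoly, charlierValue, Polynomial.eval_finsetSum,
    descPochhammer_eval_eq_descFactorial]

/-- The defining sum may be extended past `m`, which puts `C_m(x)` and `C_x(m)` over one range. -/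
theorem charlierValue_eq_sum_range (θ : ℝ) {m M : ℕ} (h : m ≤ M) (x : ℕ) :
    charlierValue θ m x = ∑ k ∈ Finset.range (M + 1),
      (m.choose k : ℝ) * (-1 / θ) ^ k * (x.descFactorial k : ℝ) := by
  refine Finset.sum_subset (Finset.range_subset_range.2 (by omega)) fun k _ hk => ?_
  rw [Nat.choose_eq_zero_of_lt (by simpa using hk)]
  simp

/-- The self-duality `C_m(x) = C_x(m)` of the Charlier polynomials on the lattice. -/
theorem charlierValue_comm (θ : ℝ) (m x : ℕ) : charlierValue θ m x = charlierValue θ x m := by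
  rw [charlierValue_eq_sum_range θ (Nat.le_add_right m x),
    charlierValue_eq_sum_range θ (Nat.le_add_left x m)]
  refine Finset.sum_congr rfl fun k _ => ?_
  rw [Nat.descFactorial_eq_factorial_mul_choose, Nat.descFactorial_eq_factorial_mul_choose]
  push_cast
  ring

@[simp]
theorem charlierValue_zero_left (θ : ℝ) (x : ℕ) : charlierValue θ 0 x = 1 := by
  simp [charlierValue]

@[simp]
theorem charlierValue_zero_right (θ : ℝ) (m : ℕ) : charlierValue θ m 0 = 1 := by
  rw [charlierValue_comm, charlierValue_zero_left]

/-- The raising relation `C_{m+1}(x) = C_m(x) - (x/θ) C_m(x-1)`. -/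
theorem charlierValue_succ_left (θ : ℝ) (m x : ℕ) :
    charlierValue θ (m + 1) (x + 1) =
      charlierValue θ m (x + 1) - (x + 1) / θ * charlierValue θ m x := by
  rw [charlierValue_eq_sum_range θ (Nat.le_add_right m 1) (x + 1), charlierValue, charlierValue,
    eq_sub_iff_add_eq, ← eq_sub_iff_add_eq', ← Finset.sum_sub_distrib, Finset.mul_sum,
    Finset.sum_range_succ' _ (m + 1)]
  simp only [Nat.choose_zero_right, sub_self, add_zero]
  refine Finset.sum_congr rfl fun k _ => ?_
  rw [Nat.choose_succ_succ, Nat.succ_descFactorial_succ]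
  push_cast
  ring

/-- The lowering relation `C_{m+1}(x+1) - C_{m+1}(x) = -((m+1)/θ) C_m(x)`. -/
theorem charlierValue_succ_right (θ : ℝ) (m x : ℕ) :
    charlierValue θ (m + 1) (x + 1) =
      charlierValue θ (m + 1) x - (m + 1) / θ * charlierValue θ m x := by
  rw [charlierValue_comm, charlierValue_succ_left, charlierValue_comm θ x, charlierValue_comm θ x]

theorem charlierValue_one_left {θ : ℝ} (x : ℕ) : charlierValue θ 1 x = 1 - x / θ := by
  simp [charlierValue, Finset.sum_range_succ]
  ring

/-- The three-term recurrence in the degree. -/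
theorem charlierValue_add_two_left {θ : ℝ} (hθ : θ ≠ 0) (m x : ℕ) :
    charlierValue θ (m + 2) x = (1 - x / θ + (m + 1) / θ) * charlierValue θ (m + 1) x
      - (m + 1) / θ * charlierValue θ m x := by
  cases x with
  | zero => simp
  | succ x =>
    have h1 := charlierValue_succ_left θ (m + 1) x
    have h2 := charlierValue_succ_right θ m x
    have h3 := charlierValue_succ_left θ m x
    push_cast
    rw [show m + 2 = m + 1 + 1 from rfl, h1]
    have h4 : charlierValue θ (m + 1) x =
      charlierValue θ (m + 1) (x + 1) + (m + 1) / θ * charlierValue θ m x := by linarith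
    rw [h4, h3]
    field_simp
    ring

/-- An exponential bound in `x`, enough against the factorial decay of the weight. -/
theorem abs_charlierValue_le {θ : ℝ} (hθ : 0 < θ) (m x : ℕ) :
    |charlierValue θ m x| ≤ m.factorial * (1 + 1 / θ) ^ x := by
  have hb : 1 ≤ 1 + 1 / θ := by simp [hθ.le]
  induction x generalizing m with
  | zero => simpa using mod_cast m.factorial_pos
  | succ x ih =>
    cases m with
    | zero => simpa using one_le_pow₀ hb
    | succ m =>
      rw [charlierValue_succ_right]
      calc _ ≤ |charlierValue θ (m + 1) x| + (m + 1) / θ * |charlierValue θ m x| := by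
            refine (abs_sub _ _).trans_eq ?_
            rw [abs_mul, abs_of_nonneg (by positivity : (0 : ℝ) ≤ (m + 1) / θ)]
        _ ≤ (m + 1).factorial * (1 + 1 / θ) ^ x
            + (m + 1) / θ * (m.factorial * (1 + 1 / θ) ^ x) := by
            gcongr <;> apply ih
        _ = _ := by
            rw [Nat.factorial_succ]
            push_cast
            ring

/-! ### Summation by parts and the norms of the Charlier polynomials -/

theorem charlierWeight_succ (θ : ℝ) (x : ℕ) :
    charlierWeight θ (x + 1) * (x + 1) = charlierWeight θ x * θ := by
  rw [charlierWeight, charlierWeight, Nat.factorial_succ]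
  push_cast
  field_simp
  ring

/-- Summation by parts: the raising relation says that `W C_{x+1}` is the backward difference of
`W C_x`, and the lowering relation that the forward difference of `C_{y+1}` is `-((y+1)/θ) C_y`. -/
theorem sum_charlierWeight_mul_succ_succ {θ : ℝ} (hθ : θ ≠ 0) (x y n : ℕ) :
    ∑ m ∈ Finset.range (n + 1),
        charlierWeight θ m * charlierValue θ (x + 1) m * charlierValue θ (y + 1) m =
      charlierWeight θ n * charlierValue θ x n * charlierValue θ (y + 1) (n + 1)
        + (y + 1) / θ * ∑ m ∈ Finset.range (n + 1),
          charlierWeight θ m * charlierValue θ x m * charlierValue θ y m := by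
  induction n with
  | zero =>
    rw [charlierValue_succ_right]
    simp [charlierWeight]
  | succ n ih =>
    rw [Finset.sum_range_succ, ih, Finset.sum_range_succ _ (n + 1),
      charlierValue_succ_right θ y (n + 1), charlierValue_succ_left θ x n]
    have h : charlierWeight θ (n + 1) * ((n + 1) / θ) = charlierWeight θ n := by
      rw [← mul_div_assoc, charlierWeight_succ, mul_div_cancel_right₀ _ hθ]
    linear_combination
      (-charlierValue θ x n * charlierValue θ (y + 1) (n + 1)) * h

/-- The sum of the backward differences of `W C_x` telescopes. -/
theorem sum_charlierWeight_mul_succ {θ : ℝ} (hθ : θ ≠ 0) (x n : ℕ) :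
    ∑ m ∈ Finset.range (n + 1), charlierWeight θ m * charlierValue θ (x + 1) m =
      charlierWeight θ n * charlierValue θ x n := by
  induction n with
  | zero => simp
  | succ n ih =>
    rw [Finset.sum_range_succ, ih, charlierValue_succ_left θ x n]
    have h : charlierWeight θ (n + 1) * ((n + 1) / θ) = charlierWeight θ n := by
      rw [← mul_div_assoc, charlierWeight_succ, mul_div_cancel_right₀ _ hθ]
    linear_combination (-charlierValue θ x n) * h

theorem charlierWeight_nonneg {θ : ℝ} (hθ : 0 < θ) (x : ℕ) : 0 ≤ charlierWeight θ x := by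
  unfold charlierWeight
  positivity

/-- The boundary term of the summation by parts vanishes at infinity. -/
theorem tendsto_charlierWeight_mul_atTop {θ : ℝ} (hθ : 0 < θ) (x : ℕ) :
    Tendsto (fun n => charlierWeight θ n * charlierValue θ x n * charlierValue θ (x + 1) (n + 1))
      atTop (𝓝 0) := by
  set b := 1 + 1 / θ with hb
  have hb0 : 0 < b := by positivity
  have h := (FloorSemiring.tendsto_pow_div_factorial_atTop (b * b * θ)).const_mul
    ((x.factorial : ℝ) * (x + 1).factorial * b)
  rw [mul_zero] at h
  refine squeeze_zero_norm (fun n => ?_) h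
  rw [Real.norm_eq_abs, abs_mul, abs_mul, abs_of_nonneg (charlierWeight_nonneg hθ n)]
  calc _ ≤ charlierWeight θ n * (x.factorial * b ^ n) * ((x + 1).factorial * b ^ (n + 1)) := by
        gcongr
        · exact mul_nonneg (charlierWeight_nonneg hθ n) (by positivity)
        · exact charlierWeight_nonneg hθ n
        · exact abs_charlierValue_le hθ x n
        · exact abs_charlierValue_le hθ (x + 1) (n + 1)
    _ = _ := by
        rw [charlierWeight, mul_pow, mul_pow]
        ring

/-- `‖C_m‖² = e^θ m! / θ^m`, by letting `n → ∞` in the summation by parts with `x = y = m`. -/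
theorem hasSum_charlierValue_sq_mul_charlierWeight {θ : ℝ} (hθ : 0 < θ) (m : ℕ) :
    HasSum (fun x => charlierValue θ m x ^ 2 * charlierWeight θ x)
      (Real.exp θ * m.factorial / θ ^ m) := by
  induction m with
  | zero =>
    simp only [charlierValue_zero_left, one_pow, one_mul, Nat.factorial_zero, Nat.cast_one,
      mul_one, pow_zero, div_one, charlierWeight]
    rw [Real.exp_eq_exp_ℝ]
    exact NormedSpace.expSeries_div_hasSum_exp θ
  | succ m ih =>
    have hnn : ∀ x, 0 ≤ charlierValue θ (m + 1) x ^ 2 * charlierWeight θ x := fun x =>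
      mul_nonneg (sq_nonneg _) (charlierWeight_nonneg hθ x)
    rw [hasSum_iff_tendsto_nat_of_nonneg hnn, ← tendsto_add_atTop_iff_nat 1]
    have h := (tendsto_charlierWeight_mul_atTop hθ m).add
      ((((tendsto_add_atTop_iff_nat 1).2 ih.tendsto_sum_nat)).const_mul (((m : ℝ) + 1) / θ))
    convert h using 1
    · funext n
      have := sum_charlierWeight_mul_succ_succ hθ.ne' m m n
      calc _ = _ := Finset.sum_congr rfl fun k _ => by ring
        _ = _ := this
        _ = _ := by
          congr 2
          exact Finset.sum_congr rfl fun k _ => by ring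
    · rw [Nat.factorial_succ, pow_succ]
      congr 1
      push_cast
      field_simp
      ring

theorem charlierNorm_eq {θ : ℝ} (hθ : 0 < θ) (m : ℕ) :
    charlierNorm m θ = √(Real.exp θ * m.factorial / θ ^ m) := by
  simp_rw [charlierNorm, charlierPoly_eval_natCast]
  rw [(hasSum_charlierValue_sq_mul_charlierWeight hθ m).tsum_eq]

/-- By self-duality the kernel is a sum over lattice points `m < N` of Charlier polynomials of the
fixed degrees `x` and `y`, the factor `‖C_m‖⁻²` being the Poisson probability of `m`. -/
theorem charlierKernel_eq_sum {θ : ℝ} (hθ : 0 < θ) (N x y : ℕ) :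
    charlierKernel N θ x y = (√(x.factorial) * √(y.factorial))⁻¹ * (√θ ^ (x + y) * Real.exp (-θ) *
      ∑ m ∈ Finset.range N, charlierWeight θ m * charlierValue θ x m * charlierValue θ y m) := by
  rw [charlierKernel, Finset.mul_sum, Finset.mul_sum]
  refine Finset.sum_congr rfl fun m _ => ?_
  have hw : ∀ z : ℕ, √(charlierWeight θ z) = √θ ^ z / √(z.factorial) := fun z => by
    rw [charlierWeight, Real.sqrt_div (by positivity)]
    congr 1
    rw [Real.sqrt_eq_iff_eq_sq (by positivity) (by positivity), ← pow_mul, mul_comm, pow_mul,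
      Real.sq_sqrt hθ.le]
  have hn : (charlierNorm m θ)⁻¹ * (charlierNorm m θ)⁻¹ = Real.exp (-θ) * charlierWeight θ m := by
    rw [← mul_inv, charlierNorm_eq hθ, Real.mul_self_sqrt (by positivity), Real.exp_neg,
      charlierWeight]
    field_simp
  simp only [charlierFun, charlierPoly_eval_natCast, hw, charlierValue_comm θ m]
  calc _ = √θ ^ x / √(x.factorial) * (√θ ^ y / √(y.factorial)) *
        ((charlierNorm m θ)⁻¹ * (charlierNorm m θ)⁻¹) *
          (charlierValue θ x m * charlierValue θ y m) := by ring
    _ = _ := by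
      rw [hn, mul_inv]
      ring

/-! ### The Gaussian tail integrals of Hermite polynomials -/

section Hermite

open Polynomial

theorem derivative_hermiteH_succ (n : ℕ) :
    derivative (hermiteH (n + 1)) = C (2 * ((n : ℝ) + 1)) * hermiteH n := by
  induction n with
  | zero => simp [hermiteH, ← C_ofNat]
  | succ n ih =>
    rw [hermiteH, derivative_sub, ih, derivative_mul, ih, derivative_C_mul, hermiteH]
    simp only [derivative_mul, derivative_ofNat, derivative_X, zero_mul, mul_one, zero_add,
      map_mul, map_add, map_one, Nat.cast_add, Nat.cast_one, map_ofNat]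
    ring

/-- The probabilists' Hermite polynomial `He_n(t) = 2^{-n/2} H_n(t/√2)`, in which the weight of the
discrete Hermite kernel becomes `e^{-t²/2}`. -/
def probHermite (n : ℕ) : ℝ[X] :=
  C (√2 ^ n)⁻¹ * (hermiteH n).comp (C (√2)⁻¹ * X)

theorem probHermite_eval (n : ℕ) (t : ℝ) :
    (probHermite n).eval t = (√2 ^ n)⁻¹ * (hermiteH n).eval (t / √2) := by
  simp [probHermite, div_eq_inv_mul]

@[simp]
theorem probHermite_zero : probHermite 0 = 1 := by simp [probHermite, hermiteH]

@[simp]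
theorem probHermite_one : probHermite 1 = X := by
  refine funext fun t => ?_
  rw [probHermite_eval]
  simp only [hermiteH, eval_sub, eval_mul, eval_X, derivative_one, eval_zero, eval_one,
    eval_ofNat]
  field_simp
  norm_num

theorem derivative_probHermite_succ (n : ℕ) :
    derivative (probHermite (n + 1)) = C ((n : ℝ) + 1) * probHermite n := by
  rw [probHermite, derivative_C_mul, derivative_comp, derivative_hermiteH_succ]
  refine funext fun t => ?_
  simp only [eval_mul, eval_C, probHermite_eval, eval_comp, derivative_C_mul, derivative_X,
    eval_X, eval_one, ← div_eq_inv_mul]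
  field_simp
  linear_combination (-((hermiteH n).eval (t / √2) * √2 ^ n)) * Real.sq_sqrt (zero_le_two (α := ℝ))

theorem probHermite_succ (n : ℕ) :
    probHermite (n + 1) = X * probHermite n - derivative (probHermite n) := by
  rw [probHermite, probHermite, derivative_C_mul, derivative_comp]
  refine funext fun t => ?_
  simp only [hermiteH, eval_mul, eval_C, eval_comp, derivative_C_mul, derivative_X, eval_sub,
    eval_X, eval_one, eval_ofNat, ← div_eq_inv_mul]
  field_simp
  linear_combination
    (-(t * (hermiteH n).eval (t / √2) * √2 ^ n)) * Real.sq_sqrt (zero_le_two (α := ℝ))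

theorem probHermite_add_two (n : ℕ) :
    probHermite (n + 2) = X * probHermite (n + 1) - C ((n : ℝ) + 1) * probHermite n := by
  rw [probHermite_succ, derivative_probHermite_succ]

theorem integrable_exp_mul_eval (p : ℝ[X]) :
    Integrable fun t : ℝ => Real.exp (-t ^ 2 / 2) * p.eval t := by
  induction p using Polynomial.induction_on' with
  | add p q hp hq =>
    simp only [eval_add, mul_add]
    exact hp.add hq
  | monomial n a =>
    have h := integrable_rpow_mul_exp_neg_mul_sq (b := 1 / 2) (by norm_num) (s := n)
      (by linarith [n.cast_nonneg (α := ℝ)])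
    refine (h.const_mul a).congr (Eventually.of_forall fun t => ?_)
    simp only [eval_monomial, Real.rpow_natCast]
    ring_nf

theorem hasDerivAt_exp_neg_sq_half_mul_eval (p : ℝ[X]) (t : ℝ) :
    HasDerivAt (fun t : ℝ => Real.exp (-t ^ 2 / 2) * p.eval t)
      (Real.exp (-t ^ 2 / 2) * (derivative p - X * p).eval t) t := by
  have h : HasDerivAt (fun t : ℝ => Real.exp (-t ^ 2 / 2)) (Real.exp (-t ^ 2 / 2) * -t) t := by
    have := ((hasDerivAt_pow 2 t).neg.div_const 2).exp
    refine this.congr_deriv ?_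
    simp only [Pi.neg_apply]
    norm_num
    ring
  refine (h.mul (p.hasDerivAt t)).congr_deriv ?_
  simp only [eval_sub, eval_mul, eval_X]
  ring

/-- `e^{-t²/2} (t p - p')` is the derivative of `-e^{-t²/2} p`. -/
theorem integral_Ioi_exp_mul_eval (p : ℝ[X]) (s : ℝ) :
    ∫ t in Set.Ioi s, Real.exp (-t ^ 2 / 2) * (X * p - derivative p).eval t =
      Real.exp (-s ^ 2 / 2) * p.eval s := by
  have h0 := tendsto_zero_of_hasDerivAt_of_integrableOn_Ioi (a := s)
    (fun t _ => hasDerivAt_exp_neg_sq_half_mul_eval p t)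
    (integrable_exp_mul_eval _).integrableOn (integrable_exp_mul_eval p).integrableOn
  have h := integral_Ioi_of_hasDerivAt_of_tendsto' (a := s)
    (fun t _ => hasDerivAt_exp_neg_sq_half_mul_eval p t)
    (integrable_exp_mul_eval _).integrableOn h0
  rw [zero_sub] at h
  rw [← neg_inj, ← h, ← integral_neg]
  congr 1
  ext t
  simp only [eval_sub, eval_mul, eval_X]
  ring

/-- `∫_s^∞ e^{-t²/2} He_x(t) He_y(t) dt`. -/
def hermiteTail (s : ℝ) (x y : ℕ) : ℝ :=
  ∫ t in Set.Ioi s, Real.exp (-t ^ 2 / 2) * (probHermite x * probHermite y).eval t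

theorem hermiteTail_comm (s : ℝ) (x y : ℕ) : hermiteTail s x y = hermiteTail s y x := by
  simp only [hermiteTail, mul_comm (probHermite x)]

theorem hermiteTail_succ_zero (s : ℝ) (x : ℕ) :
    hermiteTail s (x + 1) 0 = Real.exp (-s ^ 2 / 2) * (probHermite x).eval s := by
  rw [hermiteTail, probHermite_zero, mul_one, probHermite_succ, integral_Ioi_exp_mul_eval]

/-- Integration by parts, the continuous analogue of `sum_charlierWeight_mul_succ_succ`. -/
theorem hermiteTail_succ_succ (s : ℝ) (x y : ℕ) :
    hermiteTail s (x + 1) (y + 1) =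
      Real.exp (-s ^ 2 / 2) * ((probHermite x).eval s * (probHermite (y + 1)).eval s)
        + (y + 1) * hermiteTail s x y := by
  rw [hermiteTail, hermiteTail, ← eval_mul, ← integral_Ioi_exp_mul_eval, ← integral_const_mul,
    ← integral_add (integrable_exp_mul_eval _).integrableOn
      ((integrable_exp_mul_eval _).integrableOn.const_mul _)]
  congr 1
  ext t
  rw [derivative_mul, derivative_probHermite_succ, probHermite_succ x]
  simp only [eval_sub, eval_mul, eval_X, eval_add, eval_C]
  ring

theorem hermiteKernel_eq (s : ℝ) (x y : ℕ) :
    hermiteKernel s x y =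
      (√(x.factorial) * √(y.factorial))⁻¹ * ((√(2 * Real.pi))⁻¹ * hermiteTail s x y) := by
  have hI : ∫ t in Set.Ioi s, Real.exp (-t ^ 2 / 2) * (hermiteH x).eval (t / √2) *
      (hermiteH y).eval (t / √2) = √2 ^ (x + y) * hermiteTail s x y := by
    rw [hermiteTail, ← integral_const_mul]
    congr 1
    ext t
    rw [eval_mul, probHermite_eval, probHermite_eval, pow_add]
    field_simp
  have h2 : √((2 : ℝ) ^ (x + y)) = √2 ^ (x + y) := by
    rw [Real.sqrt_eq_iff_eq_sq (by positivity) (by positivity), ← pow_mul, mul_comm, pow_mul,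
      Real.sq_sqrt (by norm_num)]
  rw [hermiteKernel, hI, Real.rpow_neg (by positivity), ← Real.sqrt_eq_rpow,
    Real.sqrt_mul (by positivity), Real.sqrt_mul (by positivity), Real.sqrt_mul (by positivity), h2]
  field_simp

end Hermite

/-! ### Convergence of Charlier to Hermite polynomials -/

/-- Convergence of Charlier to Hermite polynomials at lattice points with `(θ - M)/√θ → s`, by
passing to the limit in the three-term recurrence. -/
theorem tendsto_sqrt_pow_mul_charlierValue {s : ℝ} {θ : ℕ → ℝ} {M : ℕ → ℕ}
    (hθ : Tendsto θ atTop atTop)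
    (h : Tendsto (fun n => (θ n - M n) / √(θ n)) atTop (𝓝 s)) (x : ℕ) :
    Tendsto (fun n => √(θ n) ^ x * charlierValue (θ n) x (M n)) atTop
      (𝓝 ((probHermite x).eval s)) := by
  have hr : Tendsto (fun n => √(θ n)) atTop atTop := Real.tendsto_sqrt_atTop.comp hθ
  have hpos : ∀ᶠ n in atTop, 0 < θ n := hθ.eventually_gt_atTop 0
  induction x using Nat.twoStepInduction with
  | zero => simp
  | one =>
    rw [probHermite_one, Polynomial.eval_X]
    refine h.congr' ?_
    filter_upwards [hpos] with n hn
    have h2 := Real.sq_sqrt hn.le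
    have hr0 := Real.sqrt_pos.2 hn
    rw [charlierValue_one_left]
    generalize √(θ n) = r at *
    rw [← h2]
    field_simp
  | more x ih1 ih2 =>
    rw [probHermite_add_two]
    simp only [Polynomial.eval_sub, Polynomial.eval_mul, Polynomial.eval_X, Polynomial.eval_C]
    have hx : Tendsto (fun n => ((x : ℝ) + 1) / √(θ n)) atTop (𝓝 0) := hr.const_div_atTop _
    have := ((h.add hx).mul ih2).sub (ih1.const_mul ((x : ℝ) + 1))
    rw [add_zero] at this
    refine this.congr' ?_
    filter_upwards [hpos] with n hn
    have h2 := Real.sq_sqrt hn.le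
    have hr0 := Real.sqrt_pos.2 hn
    rw [charlierValue_add_two_left hn.ne']
    generalize charlierValue (θ n) (x + 1) (M n) = a
    generalize charlierValue (θ n) x (M n) = b
    generalize √(θ n) = r at *
    rw [← h2]
    field_simp
    ring

/-! ### The Gamma density and the central limit theorem for the Poisson law -/

/-- The ratio of the `Gamma(n + 1)` density at `n + u√n` to its value at the mode `n`. -/
def gammaRatio (n : ℕ) (u : ℝ) : ℝ := (1 + u / √n) ^ n * Real.exp (-(u * √n))

theorem tendsto_gammaRatio {u : ℝ} {v : ℕ → ℝ} (hv : Tendsto v atTop (𝓝 u)) :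
    Tendsto (fun n => gammaRatio n (v n)) atTop (𝓝 (Real.exp (-u ^ 2 / 2))) := by
  have hr : Tendsto (fun n : ℕ => √(n : ℝ)) atTop atTop :=
    Real.tendsto_sqrt_atTop.comp tendsto_natCast_atTop_atTop
  have hw : Tendsto (fun n : ℕ => v n / √(n : ℝ)) atTop (𝓝 0) := hv.div_atTop hr
  have hw1 : Tendsto (fun n : ℕ => |v n / √(n : ℝ)|) atTop (𝓝 0) := by simpa using hw.abs
  have hlt : ∀ᶠ n : ℕ in atTop, |v n / √(n : ℝ)| < 1 := hw1.eventually_lt_const one_pos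
  have herr : Tendsto (fun n : ℕ => v n ^ 2 * (|v n / √(n : ℝ)| / (1 - |v n / √(n : ℝ)|)))
      atTop (𝓝 0) := by
    have := (hv.pow 2).mul (hw1.div (hw1.const_sub 1) (by norm_num))
    simpa using this
  -- second-order Taylor expansion of the logarithm, with the error `herr` after multiplying by `n`
  have hlog : Tendsto (fun n : ℕ => n * (Real.log (1 + v n / √(n : ℝ)) - v n / √(n : ℝ)) +
      v n ^ 2 / 2) atTop (𝓝 0) := by
    refine squeeze_zero_norm' ?_ herr
    filter_upwards [hlt, eventually_gt_atTop 0] with n hn hn0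
    have hn0' : (0 : ℝ) < n := mod_cast hn0
    have hsq : v n ^ 2 = n * (v n / √(n : ℝ)) ^ 2 := by
      rw [div_pow, Real.sq_sqrt hn0'.le]
      field_simp
    generalize v n / √(n : ℝ) = w at *
    have := Real.abs_log_sub_add_sum_range_le (x := -w) (by simpa using hn) 2
    rw [hsq, Real.norm_eq_abs]
    calc _ = n * |(∑ i ∈ Finset.range 2, (-w) ^ (i + 1) / ((i : ℝ) + 1)) + Real.log (1 - -w)| := by
          rw [← abs_of_pos hn0', ← abs_mul, abs_of_pos hn0']
          congr 1
          norm_num [Finset.sum_range_succ]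
          ring
      _ ≤ n * (|-w| ^ (2 + 1) / (1 - |-w|)) := by gcongr
      _ = _ := by
          rw [abs_neg, pow_succ, sq_abs]
          ring
  have hfin := (hlog.sub ((hv.pow 2).div_const 2)).rexp
  rw [show (0 : ℝ) - u ^ 2 / 2 = -u ^ 2 / 2 by ring] at hfin
  refine hfin.congr' ?_
  filter_upwards [hlt, eventually_gt_atTop 0] with n hn hn0
  have hn0' : (0 : ℝ) < n := mod_cast hn0
  have hpos : 0 < 1 + v n / √(n : ℝ) := by linarith [(abs_lt.1 hn).1]
  have hs : (n : ℝ) * (v n / √(n : ℝ)) = v n * √n := by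
    have h2 := Real.sq_sqrt hn0'.le
    have h0 := Real.sqrt_pos.2 hn0'
    field_simp
    rw [h2]
    ring
  rw [add_sub_cancel_right, mul_sub, hs, sub_eq_add_neg, Real.exp_add, gammaRatio,
    Real.exp_nat_mul, Real.exp_log hpos]

theorem gammaRatio_nonneg {n : ℕ} {u : ℝ} (h : 0 ≤ 1 + u / √n) : 0 ≤ gammaRatio n u := by
  unfold gammaRatio
  positivity

/-- An integrable bound uniform in `n`, for dominated convergence. -/
theorem gammaRatio_le {n : ℕ} (hn : n ≠ 0) {u : ℝ} (h : 0 ≤ 1 + u / √n) :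
    gammaRatio n u ≤ Real.exp (1 / 2) * Real.exp (-(1 / 2) * u) := by
  have hn1 : (1 : ℝ) ≤ n := mod_cast Nat.one_le_iff_ne_zero.2 hn
  have hr1 : 1 ≤ √(n : ℝ) := Real.one_le_sqrt.2 hn1
  have hsq := Real.sq_sqrt (zero_le_one.trans hn1)
  have key : ∀ c : ℝ, 1 + u / √n ≤ Real.exp c → gammaRatio n u ≤ Real.exp (n * c - u * √n) := by
    intro c hc
    rw [gammaRatio, sub_eq_add_neg, Real.exp_add, Real.exp_nat_mul]
    gcongr
  rw [← Real.exp_add]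
  rcases le_total u 0 with hu | hu
  · refine (key (u / √n) (by linarith [Real.add_one_le_exp (u / √n)])).trans
      (Real.exp_le_exp.2 ?_)
    have : (n : ℝ) * (u / √n) = u * √n := by
      nth_rw 1 [← hsq]
      field_simp
    linarith
  · have hw : 0 < 1 + u / √(n : ℝ) := by positivity
    -- `log w ≤ sinh (log w) = (w - w⁻¹) / 2`
    have hlog : Real.log (1 + u / √n) ≤ ((1 + u / √n) - (1 + u / √n)⁻¹) / 2 := by
      rw [← Real.sinh_log hw, Real.self_le_sinh_iff]
      exact Real.log_nonneg (by linarith [div_nonneg hu (zero_le_one.trans hr1)])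
    refine (key _ ((Real.log_le_iff_le_exp hw).1 hlog)).trans (Real.exp_le_exp.2 ?_)
    generalize √(n : ℝ) = r at *
    rw [← hsq]
    have hr0 : 0 < r := by linarith
    have hur : 0 < r + u := by linarith
    have e : r ^ 2 * (((1 + u / r) - (1 + u / r)⁻¹) / 2) - u * r = -(u ^ 2 * r / (2 * (r + u))) := by
      have : r + u ≠ 0 := hur.ne'
      rw [show 1 + u / r = (r + u) / r by field_simp, inv_div]
      field_simp
      ring
    rw [e]
    have : (u - 1) / 2 ≤ u ^ 2 * r / (2 * (r + u)) := by
      rw [div_le_div_iff₀ (by norm_num) (by positivity)]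
      rcases le_total u 1 with h1 | h1
      · nlinarith [mul_nonneg (sub_nonneg.2 h1) hur.le, mul_nonneg (sq_nonneg u) hr0.le]
      · nlinarith [mul_nonneg (mul_nonneg hu (sub_nonneg.2 h1)) (sub_nonneg.2 hr1)]
    linarith

/-- `√n` times the `Gamma(n + 1)` density at its mode `n`. -/
def stirlingFactor (n : ℕ) : ℝ := √n * (n : ℝ) ^ n * Real.exp (-n) / n.factorial

theorem tendsto_stirlingFactor :
    Tendsto stirlingFactor atTop (𝓝 (√(2 * Real.pi))⁻¹) := by
  have h := (Stirling.tendsto_stirlingSeq_sqrt_pi.const_mul √2).inv₀ (by positivity)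
  rw [← Real.sqrt_mul (by norm_num)] at h
  refine h.congr' ?_
  filter_upwards [eventually_gt_atTop 0] with n hn
  have hn0 : (0 : ℝ) < n := mod_cast hn
  rw [stirlingFactor, Stirling.stirlingSeq, Real.sqrt_mul (by norm_num), div_pow, Real.exp_neg,
    ← Real.exp_nat_mul, mul_one]
  field_simp

/-- As a function of `θ`, the Poisson probability `e^{-θ} θ^n / n!` is the `Gamma(n + 1)` density. -/
theorem sqrt_mul_exp_mul_charlierWeight {n : ℕ} (hn : n ≠ 0) (u : ℝ) :
    √n * (Real.exp (-(n + u * √n)) * charlierWeight (n + u * √n) n) =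
      stirlingFactor n * gammaRatio n u := by
  have hn0 : (0 : ℝ) < n := mod_cast Nat.pos_of_ne_zero hn
  have h : (n : ℝ) + u * √n = n * (1 + u / √n) := by
    have := Real.sq_sqrt hn0.le
    have h0 := Real.sqrt_pos.2 hn0
    generalize √(n : ℝ) = r at *
    rw [← this]
    field_simp
  rw [charlierWeight, stirlingFactor, gammaRatio, neg_add, Real.exp_add]
  rw [h, mul_pow]
  ring

/-- The derivative of the Poisson distribution function in `θ` is minus the `Gamma(n + 1)` density:
the sum telescopes. -/
theorem hasDerivAt_sum_charlierWeight (n : ℕ) (t : ℝ) :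
    HasDerivAt (fun t => Real.exp (-t) * ∑ m ∈ Finset.range (n + 1), charlierWeight t m)
      (-(Real.exp (-t) * charlierWeight t n)) t := by
  have hexp : HasDerivAt (fun t : ℝ => Real.exp (-t)) (-Real.exp (-t)) t := by
    simpa using (hasDerivAt_neg t).exp
  induction n with
  | zero => simpa [charlierWeight] using hexp
  | succ n ih =>
    have hw : HasDerivAt (fun t => charlierWeight t (n + 1)) (charlierWeight t n) t := by
      have := (hasDerivAt_pow (n + 1) t).div_const ((n + 1).factorial : ℝ)
      refine this.congr_deriv ?_
      rw [charlierWeight, Nat.factorial_succ]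
      push_cast
      field_simp
    have := ih.add (hexp.mul hw)
    refine (this.congr_deriv (by ring)).congr_of_eventuallyEq (Eventually.of_forall fun t => ?_)
    simp only [Finset.sum_range_succ _ (n + 1), mul_add, Pi.add_apply, Pi.mul_apply]

theorem tendsto_exp_neg_mul_sum_charlierWeight (n : ℕ) :
    Tendsto (fun t => Real.exp (-t) * ∑ m ∈ Finset.range (n + 1), charlierWeight t m)
      atTop (𝓝 0) := by
  simp_rw [Finset.mul_sum]
  rw [← Finset.sum_const_zero (s := Finset.range (n + 1)) (ι := ℕ)]
  refine tendsto_finsetSum _ fun m _ => ?_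
  have := (Real.tendsto_pow_mul_exp_neg_atTop_nhds_zero m).div_const (m.factorial : ℝ)
  rw [zero_div] at this
  refine this.congr fun t => ?_
  rw [charlierWeight]
  ring

/-- The Poisson distribution function at `n` is the tail of the `Gamma(n + 1)` law beyond `θ`, here
in the variable `u` with `θ = n + v√n`. -/
theorem integral_Ioi_gammaRatio {n : ℕ} (hn : n ≠ 0) {v : ℝ} (hv : 0 ≤ 1 + v / √n) :
    stirlingFactor n * ∫ u in Set.Ioi v, gammaRatio n u =
      Real.exp (-(n + v * √n)) * ∑ m ∈ Finset.range (n + 1), charlierWeight (n + v * √n) m := by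
  have hr0 : 0 < √(n : ℝ) := Real.sqrt_pos.2 (mod_cast Nat.pos_of_ne_zero hn)
  have hd : ∀ u ∈ Set.Ici v, HasDerivAt (fun u : ℝ => Real.exp (-(n + u * √n)) *
      ∑ m ∈ Finset.range (n + 1), charlierWeight (n + u * √n) m)
      (-(stirlingFactor n * gammaRatio n u)) u := fun u _ => by
    have h1 : HasDerivAt (fun u : ℝ => (n : ℝ) + u * √n) (√n) u := by
      simpa using ((hasDerivAt_id u).mul_const √(n : ℝ)).const_add (n : ℝ)
    have := (hasDerivAt_sum_charlierWeight n (n + u * √n)).comp u h1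
    refine this.congr_deriv ?_
    rw [← sqrt_mul_exp_mul_charlierWeight hn]
    ring
  have hlim : Tendsto (fun u : ℝ => (n : ℝ) + u * √n) atTop atTop :=
    tendsto_atTop_add_const_left _ _ (tendsto_id.atTop_mul_const hr0)
  have := integral_Ioi_of_hasDerivAt_of_nonpos' hd (fun u hu => by
    have hu' : 0 ≤ 1 + u / √(n : ℝ) := hv.trans (by gcongr; exact le_of_lt hu)
    have := gammaRatio_nonneg hu'
    have : 0 ≤ stirlingFactor n := by unfold stirlingFactor; positivity
    simp only [Left.neg_nonpos_iff]
    positivity) ((tendsto_exp_neg_mul_sum_charlierWeight n).comp hlim)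
  rw [integral_neg, integral_const_mul, zero_sub, neg_inj] at this
  exact this

theorem tendsto_integral_Ioi_gammaRatio {s : ℝ} {v : ℕ → ℝ} (hv : Tendsto v atTop (𝓝 s)) :
    Tendsto (fun n => ∫ u in Set.Ioi (v n), gammaRatio n u) atTop
      (𝓝 (∫ u in Set.Ioi s, Real.exp (-u ^ 2 / 2))) := by
  have hr : Tendsto (fun n : ℕ => √(n : ℝ)) atTop atTop :=
    Real.tendsto_sqrt_atTop.comp tendsto_natCast_atTop_atTop
  have hbase : ∀ {a : ℝ} (f : ℝ → ℝ), s - 1 ≤ a →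
      ∫ u in Set.Ioi (s - 1), (Set.Ioi a).indicator f u = ∫ u in Set.Ioi a, f u := fun f ha => by
    rw [setIntegral_indicator measurableSet_Ioi, Set.inter_eq_right.2 (Set.Ioi_subset_Ioi ha)]
  -- indicators on the fixed half-line beyond `s - 1` absorb the moving endpoint
  rw [← hbase _ (by linarith : s - 1 ≤ s)]
  have hmain : Tendsto (fun n => ∫ u in Set.Ioi (s - 1), (Set.Ioi (v n)).indicator (gammaRatio n) u)
      atTop (𝓝 (∫ u in Set.Ioi (s - 1),
        (Set.Ioi s).indicator (fun u => Real.exp (-u ^ 2 / 2)) u)) := by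
    refine tendsto_integral_filter_of_dominated_convergence
      (fun u => Real.exp (1 / 2) * Real.exp (-(1 / 2) * u)) ?_ ?_ ?_ ?_
    · refine Eventually.of_forall fun n => ?_
      refine (Measurable.indicator ?_ measurableSet_Ioi).aestronglyMeasurable
      unfold gammaRatio
      fun_prop
    · filter_upwards [hr.eventually_ge_atTop (1 - s), eventually_gt_atTop 0] with n hn hn0
      refine (ae_restrict_mem measurableSet_Ioi).mono fun u hu => ?_
      have hr0 : 0 < √(n : ℝ) := Real.sqrt_pos.2 (mod_cast hn0)
      have h : 0 ≤ 1 + u / √(n : ℝ) := by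
        have : -1 ≤ u / √(n : ℝ) := by
          rw [le_div_iff₀ hr0]
          linarith [Set.mem_Ioi.1 hu]
        linarith
      refine (norm_indicator_le_norm_self _ _).trans ?_
      rw [Real.norm_eq_abs, abs_of_nonneg (gammaRatio_nonneg h)]
      exact gammaRatio_le hn0.ne' h
    · exact (integrableOn_exp_mul_Ioi (by norm_num) _).const_mul _
    · have hne : ∀ᵐ u ∂volume.restrict (Set.Ioi (s - 1)), u ≠ s :=
        ae_restrict_of_ae (by simp [ae_iff, measure_singleton])
      filter_upwards [hne] with u hu
      rcases lt_or_gt_of_ne hu with h | h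
      · rw [Set.indicator_of_notMem (by simpa using h.le)]
        refine tendsto_const_nhds.congr' ?_
        filter_upwards [hv.eventually_const_lt h] with n hn
        rw [Set.indicator_of_notMem (by simpa using hn.le)]
      · rw [Set.indicator_of_mem (by simpa using h)]
        refine (tendsto_gammaRatio tendsto_const_nhds).congr' ?_
        filter_upwards [hv.eventually_lt_const h] with n hn
        rw [Set.indicator_of_mem (by simpa using hn)]
  refine hmain.congr' ?_
  filter_upwards [hv.eventually_const_lt (sub_one_lt s)] with n hn
  exact hbase _ hn.le

/-! ### Convergence of the kernels -/

/-- The Poisson expectation `E[r^x C_x(ξ) r^y C_y(ξ); ξ ≤ n]` with `ξ ∼ Poisson(θ)` and `r = √θ`.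
By self-duality it is the Christoffel-Darboux kernel with `N = n + 1`, up to the factor
`√(x! y!)`. -/
def scaledCharlierSum (n : ℕ) (θ : ℝ) (x y : ℕ) : ℝ :=
  √θ ^ (x + y) * Real.exp (-θ) * ∑ m ∈ Finset.range (n + 1),
    charlierWeight θ m * charlierValue θ x m * charlierValue θ y m

theorem scaledCharlierSum_comm (n : ℕ) (θ : ℝ) (x y : ℕ) :
    scaledCharlierSum n θ x y = scaledCharlierSum n θ y x := by
  simp only [scaledCharlierSum, add_comm x y, mul_right_comm _ (charlierValue θ x _)]

theorem scaledCharlierSum_succ_zero {θ : ℝ} (hθ : 0 < θ) (n x : ℕ) :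
    scaledCharlierSum n θ (x + 1) 0 =
      √θ * (Real.exp (-θ) * charlierWeight θ n) * (√θ ^ x * charlierValue θ x n) := by
  simp only [scaledCharlierSum, charlierValue_zero_left, mul_one, add_zero,
    sum_charlierWeight_mul_succ hθ.ne']
  ring

theorem scaledCharlierSum_succ_succ {θ : ℝ} (hθ : 0 < θ) (n x y : ℕ) :
    scaledCharlierSum n θ (x + 1) (y + 1) =
      √θ * (Real.exp (-θ) * charlierWeight θ n) * ((√θ ^ x * charlierValue θ x n) *
          (√θ ^ (y + 1) * charlierValue θ (y + 1) (n + 1)))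
        + (y + 1) * scaledCharlierSum n θ x y := by
  have h : √θ ^ (x + 1 + (y + 1)) = √θ ^ (x + y) * θ := by
    rw [show x + 1 + (y + 1) = x + y + 2 by ring, pow_add, Real.sq_sqrt hθ.le]
  have h' : √θ ^ (x + y) * θ = √θ * (√θ ^ x * √θ ^ (y + 1)) := by
    rw [← h]
    ring
  rw [scaledCharlierSum, sum_charlierWeight_mul_succ_succ hθ.ne', scaledCharlierSum, h]
  have e : ∀ S : ℝ, (√θ ^ (x + y) * θ) * Real.exp (-θ) * ((y + 1) / θ * S) =
      (y + 1) * (√θ ^ (x + y) * Real.exp (-θ) * S) := fun S => by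
    field_simp
  rw [mul_add, e, h']
  ring

theorem tendsto_div_natCast_of_tendsto_sub_div_sqrt {s : ℝ} {θ : ℕ → ℝ}
    (h : Tendsto (fun n : ℕ => (θ n - n) / √n) atTop (𝓝 s)) :
    Tendsto (fun n : ℕ => θ n / n) atTop (𝓝 1) := by
  have hr : Tendsto (fun n : ℕ => √(n : ℝ)) atTop atTop :=
    Real.tendsto_sqrt_atTop.comp tendsto_natCast_atTop_atTop
  have := (h.div_atTop hr).const_add 1
  rw [add_zero] at this
  refine this.congr' ?_
  filter_upwards [eventually_gt_atTop 0] with n hn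
  have hn0 : (0 : ℝ) < n := mod_cast hn
  rw [div_div, Real.mul_self_sqrt hn0.le]
  field_simp
  ring

theorem tendsto_atTop_of_tendsto_sub_div_sqrt {s : ℝ} {θ : ℕ → ℝ}
    (h : Tendsto (fun n : ℕ => (θ n - n) / √n) atTop (𝓝 s)) : Tendsto θ atTop atTop := by
  refine ((tendsto_div_natCast_of_tendsto_sub_div_sqrt h).pos_mul_atTop one_pos
    tendsto_natCast_atTop_atTop).congr' ?_
  filter_upwards [eventually_gt_atTop 0] with n hn
  have hn0 : (n : ℝ) ≠ 0 := mod_cast hn.ne'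
  field_simp

/-- By induction along the diagonals of `(x, y)`: the summation-by-parts recursion for the Charlier
sums converges term by term to the integration-by-parts recursion for `hermiteTail`. -/
theorem tendsto_scaledCharlierSum {s : ℝ} {θ : ℕ → ℝ}
    (h : Tendsto (fun n : ℕ => (θ n - n) / √n) atTop (𝓝 s)) (x y : ℕ) :
    Tendsto (fun n => scaledCharlierSum n (θ n) x y) atTop
      (𝓝 ((√(2 * Real.pi))⁻¹ * hermiteTail s x y)) := by
  have hratio := tendsto_div_natCast_of_tendsto_sub_div_sqrt h
  have hsqrt : Tendsto (fun n : ℕ => √(θ n) / √n) atTop (𝓝 1) := by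
    have := hratio.sqrt
    rw [Real.sqrt_one] at this
    refine this.congr fun n => ?_
    rw [Real.sqrt_div' _ n.cast_nonneg]
  have htop := tendsto_atTop_of_tendsto_sub_div_sqrt h
  have hpos : ∀ᶠ n in atTop, 0 < θ n := htop.eventually_gt_atTop 0
  have hM : Tendsto (fun n : ℕ => (θ n - n) / √(θ n)) atTop (𝓝 s) := by
    have := h.div hsqrt one_ne_zero
    rw [div_one] at this
    refine this.congr' ?_
    filter_upwards [eventually_gt_atTop 0] with n hn
    have hn0 : √(n : ℝ) ≠ 0 := (Real.sqrt_pos.2 (mod_cast hn)).ne'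
    simp only [Pi.div_apply]
    field_simp
  have hM1 : Tendsto (fun n : ℕ => (θ n - ((n + 1 : ℕ) : ℝ)) / √(θ n)) atTop (𝓝 s) := by
    have h1 : Tendsto (fun n : ℕ => 1 / √(θ n)) atTop (𝓝 0) :=
      (Real.tendsto_sqrt_atTop.comp htop).const_div_atTop 1
    have := hM.sub h1
    rw [sub_zero] at this
    refine this.congr fun n => ?_
    push_cast
    ring
  have hv : ∀ᶠ n : ℕ in atTop, (n : ℝ) + (θ n - n) / √n * √n = θ n := by
    filter_upwards [eventually_gt_atTop 0] with n hn
    rw [div_mul_cancel₀ _ (Real.sqrt_pos.2 (mod_cast hn)).ne', add_sub_cancel]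
  -- the local limit theorem for the Poisson weight at `n`
  have hlocal : Tendsto (fun n : ℕ => √(θ n) * (Real.exp (-θ n) * charlierWeight (θ n) n)) atTop
      (𝓝 ((√(2 * Real.pi))⁻¹ * Real.exp (-s ^ 2 / 2))) := by
    have := hsqrt.mul (tendsto_stirlingFactor.mul (tendsto_gammaRatio h))
    rw [one_mul] at this
    refine this.congr' ?_
    filter_upwards [eventually_gt_atTop 0, hv] with n hn hvn
    have hn0 : √(n : ℝ) ≠ 0 := (Real.sqrt_pos.2 (mod_cast hn)).ne'
    rw [← sqrt_mul_exp_mul_charlierWeight hn.ne', hvn]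
    field_simp
  -- the central limit theorem for the Poisson law, through the Gamma tail
  have hzero : Tendsto (fun n => scaledCharlierSum n (θ n) 0 0) atTop
      (𝓝 ((√(2 * Real.pi))⁻¹ * hermiteTail s 0 0)) := by
    have := tendsto_stirlingFactor.mul (tendsto_integral_Ioi_gammaRatio h)
    simp only [hermiteTail, probHermite_zero, mul_one, Polynomial.eval_one]
    refine this.congr' ?_
    filter_upwards [eventually_gt_atTop 0, hv, hpos] with n hn hvn hp
    have hn0 : 0 < √(n : ℝ) := Real.sqrt_pos.2 (mod_cast hn)
    rw [integral_Ioi_gammaRatio hn.ne', hvn]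
    · simp [scaledCharlierSum]
    · have : (1 + (θ n - n) / √n / √n) = θ n / n := by
        have hn1 : (n : ℝ) ≠ 0 := mod_cast hn.ne'
        rw [div_div, Real.mul_self_sqrt n.cast_nonneg]
        field_simp
        ring
      rw [this]
      positivity
  have hsucc : ∀ x, Tendsto (fun n => scaledCharlierSum n (θ n) (x + 1) 0) atTop
      (𝓝 ((√(2 * Real.pi))⁻¹ * hermiteTail s (x + 1) 0)) := fun x => by
    rw [hermiteTail_succ_zero, ← mul_assoc]
    refine (hlocal.mul (tendsto_sqrt_pow_mul_charlierValue htop hM x)).congr' ?_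
    filter_upwards [hpos] with n hn
    rw [scaledCharlierSum_succ_zero hn]
  induction x generalizing y with
  | zero =>
    cases y with
    | zero => exact hzero
    | succ y =>
      rw [hermiteTail_comm]
      exact (hsucc y).congr fun n => scaledCharlierSum_comm _ _ _ _
  | succ x ih =>
    cases y with
    | zero => exact hsucc x
    | succ y =>
      have := (hlocal.mul ((tendsto_sqrt_pow_mul_charlierValue htop hM x).mul
        (tendsto_sqrt_pow_mul_charlierValue htop hM1 (y + 1)))).add
          ((ih y).const_mul ((y : ℝ) + 1))
      rw [hermiteTail_succ_succ, show ∀ a b c d e : ℝ, a * (b * c + d * e) =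
        a * b * c + d * (a * e) by intros; ring]
      refine this.congr' ?_
      filter_upwards [hpos] with n hn
      rw [scaledCharlierSum_succ_succ hn]

/-- The hypothesis `θ(N) = N + (s + o(1)) √N` with `N = n + 1`, normalized by `n`: the largest lattice
point in the `N`-th kernel is `N - 1`, and the Gamma density and Stirling's formula are indexed by
it. -/
theorem tendsto_sub_div_sqrt {s : ℝ} {θ : ℕ → ℝ}
    (hθ : (fun N : ℕ => θ N - ((N : ℝ) + s * √(N : ℝ))) =o[atTop] fun N : ℕ => √(N : ℝ)) :
    Tendsto (fun n : ℕ => (θ (n + 1) - n) / √n) atTop (𝓝 s) := by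
  have h1 : Tendsto (fun N : ℕ => (θ N - N) / √N) atTop (𝓝 s) := by
    have := hθ.tendsto_div_nhds_zero.add_const s
    rw [zero_add] at this
    refine this.congr' ?_
    filter_upwards [eventually_gt_atTop 0] with n hn
    have hn0 : √(n : ℝ) ≠ 0 := (Real.sqrt_pos.2 (mod_cast hn)).ne'
    field_simp
    ring
  have hr : Tendsto (fun n : ℕ => √(n : ℝ)) atTop atTop :=
    Real.tendsto_sqrt_atTop.comp tendsto_natCast_atTop_atTop
  have h2 : Tendsto (fun n : ℕ => √((n + 1 : ℕ) : ℝ) / √n) atTop (𝓝 1) := by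
    have := ((tendsto_one_div_atTop_nhds_zero_nat (𝕜 := ℝ)).const_add 1).sqrt
    rw [add_zero, Real.sqrt_one] at this
    refine this.congr' ?_
    filter_upwards [eventually_gt_atTop 0] with n hn
    have hn0 : (n : ℝ) ≠ 0 := mod_cast hn.ne'
    rw [← Real.sqrt_div' _ n.cast_nonneg]
    congr 1
    push_cast
    field_simp
  have := (((tendsto_add_atTop_iff_nat 1).2 h1).mul h2).add (hr.const_div_atTop 1)
  rw [mul_one, add_zero] at this
  refine this.congr' ?_
  filter_upwards [eventually_gt_atTop 0] with n hn
  have hn0 : √(n : ℝ) ≠ 0 := (Real.sqrt_pos.2 (mod_cast hn)).ne'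
  have hn1 : √((n + 1 : ℕ) : ℝ) ≠ 0 := (Real.sqrt_pos.2 (mod_cast n.succ_pos)).ne'
  field_simp
  push_cast
  ring

end DiscreteHermite

end

theorem lemma4p4 (s : ℝ) (θ : ℕ → ℝ)
    (hθ : (fun N : ℕ => θ N - ((N : ℝ) + s * √(N : ℝ))) =o[atTop] fun N : ℕ => √(N : ℝ))
    (x y : ℕ) :
    Tendsto (fun N : ℕ => DiscreteHermite.charlierKernel N (θ N) x y) atTop
      (𝓝 (DiscreteHermite.hermiteKernel s x y)) := by
  have h := DiscreteHermite.tendsto_sub_div_sqrt hθ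
  rw [DiscreteHermite.hermiteKernel_eq, ← tendsto_add_atTop_iff_nat 1]
  refine ((DiscreteHermite.tendsto_scaledCharlierSum h x y).const_mul _).congr' ?_
  filter_upwards [(DiscreteHermite.tendsto_atTop_of_tendsto_sub_div_sqrt h).eventually_gt_atTop 0]
    with n hn
  rw [DiscreteHermite.charlierKernel_eq_sum hn]
  rfl
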